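/- Let $D_2$ (the Klein group) act on $\mathbb R^2$ by $(q_1,q_2)\mapsto(\pm q_1,\pm q_2)$. The $D_2$ dihedral vortex problem for the position $q=(q_1,q_2)$ of one of the four vortices (the others are its images under $D_2$) is the Hamiltonian system $$\pi\,\dot q=p,\qquad \dot p=\nabla U(q),\qquad U(q)=-\sum_{g\in D_2\setminus\{1\}}\log\|q-gq\|=-\log\bigl(8\,\|q\|\,|q_1|\,|q_2|\bigr),$$ with energy $H(q,p)=\frac{1}{2\pi}\|p\|^2-U(q)$. A generalized solution on an interval $J\subseteq\mathbb R$ (bounded or unbounded) is a curve $(q,p)$ for which there is a finite set $Y\subset \operatorname{int}J$ such that $q$ is continuous on $J$; at each time in $J\setminus Y$ one has $q_1q_2\neq0$ and $(q,p)$ solves the system above; and at each $\sigma\in Y$ the solution has a binary collision and is continued by transmission, that is: exactly one coordinate of $q(\sigma)$ is zero, this coordinate changes sign at $\sigma$, the momentum belonging to the other coordinate has one and the same finite limit as $t\to\sigma^{-}$ and as $t\to\sigma^{+}$, and $H(q(t),p(t))$ has the same value just before and just after $\sigma$. Theorem. For every generalized solution $(q,p)$ of the $D_2$ dihedral vortex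 problem on an interval $J$, the projection $q(J)$ onto the configuration space is a bounded subset of $\mathbb R^2$. -/

import Mathlib

open Set Filter Topology

noncomputable section

namespace VortexD2

/-- The plane in which the representative vortex of a `D₂`-equivariant configuration moves. -/
abbrev Plane := EuclideanSpace ℝ (Fin 2)

/-- The action of the dihedral group `D₂` (the Klein group) on the plane: the rotations act by
`z ↦ z` and `z ↦ -z`, the remaining two elements by `z ↦ conj z` and `z ↦ -conj z`.
The four vortices of the configuration generated by `q` are at `act g q`, `g ∈ D₂`. -/
def act : DihedralGroup 2 → Plane → Plane
  | .r k, q => if k = 0 then q else -q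
  | .sr k, q => if k = 0 then !₂[q 0, -q 1] else !₂[-q 0, q 1]

/-- The logarithmic dihedral potential `U(q) = -∑_{g ≠ 1} log ‖q - g q‖`. -/
def U (q : Plane) : ℝ :=
  -∑ g ∈ (Finset.univ : Finset (DihedralGroup 2)).erase 1, Real.log ‖q - act g q‖

/-- The Hamiltonian `H(q, p) = ½ ⟨Γ⁻¹ p, p⟩ - U(q)`, where `Γ = π I`. -/
def energy (q p : Plane) : ℝ := ‖p‖ ^ 2 / (2 * Real.pi) - U q

/-- No two of the four vortices collide. -/
def CollisionFree (q : Plane) : Prop := ∀ g : DihedralGroup 2, g ≠ 1 → act g q ≠ q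

/-- At time `σ` the curve `(q, p)` has a simultaneous binary collision and is continued by
transmission. Exactly one coordinate `i` of `q` vanishes at `σ`; as in the transmission
`q̄ (σ + s) = -q̄ (σ - s)` of a collision path of the one-centre problem, this coordinate passes
to the other side of the singularity, with the energy it came in with. The other coordinate,
on which the force stays finite, passes through `σ` with a continuous velocity. Since the
velocity of coordinate `i` is infinite at `σ`, it is the conservation of energy which determines
the outgoing branch from the incoming one. -/
def IsTransmission (q p : ℝ → Plane) (σ : ℝ) : Prop :=
  ∃ i j : Fin 2, i ≠ j ∧ q σ i = 0 ∧ q σ j ≠ 0 ∧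
    (∀ᶠ s in 𝓝[>] (0 : ℝ), q (σ - s) i * q (σ + s) i < 0) ∧
    (∃ v : ℝ, Tendsto (fun t => p t j) (𝓝[≠] σ) (𝓝 v)) ∧
    (∃ h : ℝ, ∀ᶠ t in 𝓝[≠] σ, energy (q t) (p t) = h)

/-- `(q, p)` is a generalized solution of the `D₂` problem on the interval `J` (of any kind,
bounded or not) with the finite set `Y` of collision times: `q` is continuous on `J`; off `Y` the
curve `(q, p)` is collision free and solves Hamilton's equations `Γ q̇ = p`, `ṗ = ∂U/∂q` with
`Γ = π I`, that is `Γ q̈ = ∂U/∂q`; at each time in `Y` it has a binary collision and is continued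
by transmission. The values of `p` at the times in `Y` are irrelevant. -/
structure IsGeneralizedSolution (J : Set ℝ) (Y : Finset ℝ) (q p : ℝ → Plane) : Prop where
  interval : J.OrdConnected
  collision_times : (Y : Set ℝ) ⊆ interior J
  continuousOn : ContinuousOn q J
  collisionFree : ∀ t ∈ J \ (Y : Set ℝ), CollisionFree (q t)
  velocity : ∀ t ∈ J \ (Y : Set ℝ), HasDerivWithinAt q (Real.pi⁻¹ • p t) J t
  force : ∀ t ∈ J \ (Y : Set ℝ), HasDerivWithinAt p (gradient U (q t)) J t
  transmission : ∀ σ ∈ Y, IsTransmission q p σ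

end VortexD2

end

namespace VortexD2

/-! On a collision-free interval each force component points to its axis, so `|q 0|` and `|q 1|` are
positive concave functions of time (`IsSolutionOn.concaveOn_abs`). Over a bounded time span they lie
below tangent lines. Over an unbounded one, they cannot fall below their values at a base time `a`,
or concavity would make them negative; since energy conservation bounds `8 ‖q‖ |q 0| |q 1|`, the two
lower bounds yield an upper bound on `‖q‖`. Finitely many collision times cut `J` into finitely many
such intervals, whose bounds need not be related. -/

/-- A nonnegative concave function does not drop along a ray contained in its domain. -/
lemma le_of_concaveOn_of_ray_subset {K : Set ℝ} {f : ℝ → ℝ} (hf : ConcaveOn ℝ K f)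
    (hpos : ∀ x ∈ K, 0 ≤ f x) {a t : ℝ}
    (hray : ∀ r : ℝ, 0 ≤ r → a + r * (t - a) ∈ K) : f a ≤ f t := by
  have ha : a ∈ K := by simpa using hray 0 le_rfl
  -- `t` is a convex combination of `a` and a point `n + 1` times as far out, where `f` is
  -- nonnegative; then `n → ∞`.
  have key : ∀ n : ℕ, (1 - 1 / ((n : ℝ) + 1)) * f a ≤ f t := by
    intro n
    have hn : (0 : ℝ) < n + 1 := by positivity
    have h1 : 1 / ((n : ℝ) + 1) ≤ 1 := by
      rw [div_le_one hn]
      linarith [n.cast_nonneg (α := ℝ)]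
    have hb := hray ((n : ℝ) + 1) hn.le
    have h := hf.2 ha hb (sub_nonneg.2 h1) (by positivity : 0 ≤ 1 / ((n : ℝ) + 1)) (by ring)
    have he : (1 - 1 / ((n : ℝ) + 1)) • a + (1 / ((n : ℝ) + 1)) • (a + ((n : ℝ) + 1) * (t - a))
        = t := by
      simp only [smul_eq_mul]
      field_simp
      ring
    rw [he] at h
    have h0 : 0 ≤ 1 / ((n : ℝ) + 1) * f (a + ((n : ℝ) + 1) * (t - a)) :=
      mul_nonneg (by positivity) (hpos _ hb)
    simp only [smul_eq_mul] at h
    linarith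
  have hlim : Tendsto (fun n : ℕ => (1 - 1 / ((n : ℝ) + 1)) * f a) atTop (𝓝 ((1 - 0) * f a)) :=
    (tendsto_one_div_add_atTop_nhds_zero_nat.const_sub 1).mul_const _
  have := le_of_tendsto' hlim key
  simpa using this

/-- A concave function lies below its tangent lines. -/
lemma le_tangent_of_concaveOn {K : Set ℝ} {f : ℝ → ℝ} (hf : ConcaveOn ℝ K f) {a m t : ℝ}
    (ha : a ∈ K) (ht : t ∈ K) (hm : HasDerivWithinAt f m K a) : f t ≤ f a + m * (t - a) := by
  rcases lt_trichotomy a t with h | rfl | h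
  · have := hf.slope_le_of_hasDerivWithinAt ha ht h hm
    rw [slope_def_field, div_le_iff₀ (sub_pos.2 h)] at this
    linarith
  · simp
  · have := hf.le_slope_of_hasDerivWithinAt ht ha h hm
    rw [slope_def_field, le_div_iff₀ (sub_pos.2 h)] at this
    linarith

/-! ### The potential and its gradient -/

lemma CollisionFree.ne_zero {q : Plane} (h : CollisionFree q) (i : Fin 2) : q i ≠ 0 := by
  intro h0
  fin_cases i
  · change q 0 = 0 at h0
    refine h (.sr 1) (by decide) ?_
    ext j
    fin_cases j
    · simp [act, h0]
    · simp [act]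
  · change q 1 = 0 at h0
    refine h (.sr 0) (by decide) ?_
    ext j
    fin_cases j
    · simp [act]
    · simp [act, h0]

/-- Collisions are allowed because `Real.log 0 = 0` on both sides; only merging the logarithms needs
nonzero factors. -/
lemma U_eq (q : Plane) :
    U q = -(Real.log (2 * ‖q‖) + Real.log (2 * |q 0|) + Real.log (2 * |q 1|)) := by
  have hset : (Finset.univ : Finset (DihedralGroup 2)).erase 1
      = {.r 1, .sr 0, .sr 1} := by decide
  have h1 : ‖q - act (.r 1) q‖ = 2 * ‖q‖ := by
    have : q - act (.r 1) q = (2 : ℝ) • q := by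
      simp [act, two_smul]
    rw [this, norm_smul]
    simp
  have h2 : ‖q - act (.sr 0) q‖ = 2 * |q 1| := by
    rw [EuclideanSpace.norm_eq]
    simp only [act, Fin.sum_univ_two]
    simp [← two_mul]
  have h3 : ‖q - act (.sr 1) q‖ = 2 * |q 0| := by
    rw [EuclideanSpace.norm_eq]
    simp only [act, Fin.sum_univ_two]
    simp [← two_mul]
  rw [U, hset, Finset.sum_insert (by decide), Finset.sum_insert (by decide),
    Finset.sum_singleton, h1, h2, h3]
  ring

lemma CollisionFree.ne_zero' {q : Plane} (h : CollisionFree q) : q ≠ 0 := by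
  rintro rfl
  exact h.ne_zero 0 rfl

lemma CollisionFree.U_eq_log {q : Plane} (h : CollisionFree q) :
    U q = -Real.log (8 * ‖q‖ * |q 0| * |q 1|) := by
  have h0 := abs_ne_zero.2 (h.ne_zero 0)
  have h1 := abs_ne_zero.2 (h.ne_zero 1)
  have hn := norm_ne_zero_iff.2 h.ne_zero'
  rw [U_eq, ← Real.log_mul (by positivity) (by positivity),
    ← Real.log_mul (by positivity) (by positivity)]
  ring_nf

lemma CollisionFree.eventually {q : Plane} (h : CollisionFree q) :
    ∀ᶠ x : Plane in 𝓝 q, x 0 ≠ 0 ∧ x 1 ≠ 0 := by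
  have hc : ∀ i : Fin 2, Continuous fun x : Plane => x i := fun i => by fun_prop
  exact ((hc 0).continuousAt.eventually_ne (h.ne_zero 0)).and
    ((hc 1).continuousAt.eventually_ne (h.ne_zero 1))

lemma CollisionFree.hasGradientAt_U {q : Plane} (h : CollisionFree q) :
    HasGradientAt U (!₂[-(q 0 / ‖q‖ ^ 2 + 1 / q 0), -(q 1 / ‖q‖ ^ 2 + 1 / q 1)] : Plane) q := by
  have h0 := h.ne_zero 0
  have h1 := h.ne_zero 1
  have hn := norm_ne_zero_iff.2 h.ne_zero'
  -- Half the logarithm of `‖x‖ ^ 2` avoids differentiating the norm itself.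
  have hev : U =ᶠ[𝓝 q] fun x : Plane =>
      -(3 * Real.log 2 + 2⁻¹ * Real.log (‖x‖ ^ 2) + Real.log (x 0) + Real.log (x 1)) := by
    filter_upwards [h.eventually] with x hx
    have hxn : ‖x‖ ≠ 0 := by
      rw [norm_ne_zero_iff]
      rintro rfl
      exact hx.1 rfl
    rw [U_eq, Real.log_mul two_ne_zero hxn, Real.log_mul two_ne_zero (abs_ne_zero.2 hx.1),
      Real.log_mul two_ne_zero (abs_ne_zero.2 hx.2), Real.log_abs, Real.log_abs, Real.log_pow]
    push_cast
    ring
  rw [hasGradientAt_iff_hasFDerivAt]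
  refine HasFDerivAt.congr_of_eventuallyEq ?_ hev
  have hproj : ∀ i : Fin 2, HasFDerivAt (fun x : Plane => x i)
      (EuclideanSpace.proj i : Plane →L[ℝ] ℝ) q :=
    fun i => (EuclideanSpace.proj i : Plane →L[ℝ] ℝ).hasFDerivAt
  have hnorm : HasFDerivAt (fun x : Plane => ‖x‖ ^ 2) (2 • (innerSL ℝ q)) q :=
    (hasStrictFDerivAt_norm_sq q).hasFDerivAt
  have hd := (((((hnorm.log (pow_ne_zero 2 hn)).const_mul 2⁻¹).const_add (3 * Real.log 2)).add
    ((hproj 0).log h0)).add ((hproj 1).log h1)).neg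
  convert! hd using 1
  ext v
  simp [PiLp.inner_apply, Fin.sum_univ_two]
  field_simp
  ring

/-- Attraction to the axes: the product equals `-(q i ^ 2 / ‖q‖ ^ 2 + 1)`. -/
lemma CollisionFree.mul_gradient_nonpos {q : Plane} (h : CollisionFree q) (i : Fin 2) :
    q i * gradient U q i ≤ 0 := by
  have hi := h.ne_zero i
  have key : q i * -(q i / ‖q‖ ^ 2 + 1 / q i) ≤ 0 := by
    have : q i * -(q i / ‖q‖ ^ 2 + 1 / q i) = -(q i ^ 2 / ‖q‖ ^ 2 + 1) := by
      field_simp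
    rw [this, neg_nonpos]
    positivity
  rw [h.hasGradientAt_U.gradient]
  fin_cases i <;> simpa using key

/-! ### Solutions without collisions -/

/-- A collision-free solution of Hamilton's equations on the interval `K`. -/
structure IsSolutionOn (K : Set ℝ) (q p : ℝ → Plane) : Prop where
  interval : K.OrdConnected
  collisionFree : ∀ t ∈ K, CollisionFree (q t)
  velocity : ∀ t ∈ K, HasDerivWithinAt q (Real.pi⁻¹ • p t) K t
  force : ∀ t ∈ K, HasDerivWithinAt p (gradient U (q t)) K t

namespace IsSolutionOn

variable {K : Set ℝ} {q p : ℝ → Plane}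

lemma velocity_apply (h : IsSolutionOn K q p) (i : Fin 2) {t : ℝ} (ht : t ∈ K) :
    HasDerivWithinAt (fun s => q s i) (Real.pi⁻¹ * p t i) K t := by
  exact (EuclideanSpace.proj i : Plane →L[ℝ] ℝ).hasFDerivAt.comp_hasDerivWithinAt t
    (h.velocity t ht)

lemma force_apply (h : IsSolutionOn K q p) (i : Fin 2) {t : ℝ} (ht : t ∈ K) :
    HasDerivWithinAt (fun s => p s i) (gradient U (q t) i) K t := by
  exact (EuclideanSpace.proj i : Plane →L[ℝ] ℝ).hasFDerivAt.comp_hasDerivWithinAt t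
    (h.force t ht)

lemma hasDerivWithinAt_energy (h : IsSolutionOn K q p) {t : ℝ} (ht : t ∈ K) :
    HasDerivWithinAt (fun s => energy (q s) (p s)) 0 K t := by
  have hU : HasFDerivAt U (InnerProductSpace.toDual ℝ Plane (gradient U (q t))) (q t) :=
    (h.collisionFree t ht).hasGradientAt_U.differentiableAt.hasGradientAt
  have h1 := hU.comp_hasDerivWithinAt t (h.velocity t ht)
  have h2 := ((h.force t ht).norm_sq.div_const (2 * Real.pi)).sub h1
  convert! h2 using 1
  rw [InnerProductSpace.toDual_apply_apply, inner_smul_right, real_inner_comm]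
  field_simp
  ring

lemma energy_eq (h : IsSolutionOn K q p) {s t : ℝ} (hs : s ∈ K) (ht : t ∈ K) :
    energy (q t) (p t) = energy (q s) (p s) := by
  have := h.interval.convex.norm_image_sub_le_of_norm_hasDerivWithin_le (C := 0)
    (fun x hx => h.hasDerivWithinAt_energy hx) (by simp) hs ht
  rw [zero_mul] at this
  exact sub_eq_zero.1 (norm_le_zero_iff.1 this)

/-- Energy conservation confines a solution to the region where `8 ‖q‖ |q₀| |q₁|` is bounded. -/
lemma norm_mul_abs_mul_abs_le (h : IsSolutionOn K q p) {s t : ℝ} (hs : s ∈ K) (ht : t ∈ K) :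
    8 * ‖q t‖ * |q t 0| * |q t 1| ≤ Real.exp (energy (q s) (p s)) := by
  have hc := h.collisionFree t ht
  have h0 := abs_pos.2 (hc.ne_zero 0)
  have h1 := abs_pos.2 (hc.ne_zero 1)
  have hn := norm_pos_iff.2 hc.ne_zero'
  rw [← Real.log_le_iff_le_exp (by positivity), ← h.energy_eq hs ht, energy, hc.U_eq_log]
  have : 0 ≤ ‖p t‖ ^ 2 / (2 * Real.pi) := by positivity
  linarith

/-- By connectedness `q i` keeps its sign, so the absolute value can be differentiated as a constant
multiple of `q i`. -/
lemma abs_eq (h : IsSolutionOn K q p) (i : Fin 2) :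
    ∃ ε : ℝ, ∀ t ∈ K, |q t i| = ε * q t i := by
  have hcont : ContinuousOn (fun t => q t i) K := fun t ht =>
    (h.velocity_apply i ht).continuousWithinAt
  have hoc : ((fun t => q t i) '' K).OrdConnected :=
    (h.interval.isPreconnected.image _ hcont).ordConnected
  have hne : (0 : ℝ) ∉ (fun t => q t i) '' K := by
    rintro ⟨t, ht, h0⟩
    exact (h.collisionFree t ht).ne_zero i h0
  by_cases hpos : ∃ s ∈ K, 0 < q s i
  · obtain ⟨s, hs, hs0⟩ := hpos
    refine ⟨1, fun t ht => ?_⟩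
    rw [one_mul, abs_of_nonneg]
    by_contra! hlt
    exact hne (hoc.out (mem_image_of_mem _ ht) (mem_image_of_mem _ hs) ⟨hlt.le, hs0.le⟩)
  · push Not at hpos
    refine ⟨-1, fun t ht => ?_⟩
    rw [abs_of_nonpos (hpos t ht), neg_one_mul]

/-- Each coordinate is attracted by its axis, so that its distance to it is concave in time. -/
lemma concaveOn_abs (h : IsSolutionOn K q p) (i : Fin 2) :
    ConcaveOn ℝ K (fun t => |q t i|) := by
  obtain ⟨ε, hε⟩ := h.abs_eq i
  have hint : interior K ⊆ K := interior_subset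
  have hc : ConcaveOn ℝ K (fun t => ε * q t i) := by
    refine concaveOn_of_hasDerivWithinAt2_nonpos h.interval.convex
      (f' := fun t => ε * (Real.pi⁻¹ * p t i))
      (f'' := fun t => ε * (Real.pi⁻¹ * gradient U (q t) i)) ?_ ?_ ?_ ?_
    · exact fun t ht => ((h.velocity_apply i ht).const_mul ε).continuousWithinAt
    · exact fun t ht => ((h.velocity_apply i (hint ht)).const_mul ε).mono hint
    · exact fun t ht => (((h.force_apply i (hint ht)).const_mul _).const_mul ε).mono hint
    · intro t ht
      have hcf := h.collisionFree t (hint ht)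
      have hq : 0 < ε * q t i := hε t (hint ht) ▸ abs_pos.2 (hcf.ne_zero i)
      have hg := hcf.mul_gradient_nonpos i
      have hq2 : 0 < q t i ^ 2 := by
        have := hcf.ne_zero i
        positivity
      -- The factor `q t i ^ 2` splits into one `q t i` that makes `ε` positive and one that turns
      -- the gradient into the known sign.
      have hprod : (ε * (Real.pi⁻¹ * gradient U (q t) i)) * q t i ^ 2 ≤ 0 := by
        have : (ε * (Real.pi⁻¹ * gradient U (q t) i)) * q t i ^ 2
            = (ε * q t i * Real.pi⁻¹) * (q t i * gradient U (q t) i) := by ring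
        rw [this]
        exact mul_nonpos_of_nonneg_of_nonpos (by positivity) hg
      exact nonpos_of_mul_nonpos_left hprod hq2
  exact hc.congr fun t ht => (hε t ht).symm

/-- If the ray from `a` through `t` is contained in the time interval, the conserved energy
bounds the position at time `t`. -/
lemma norm_le_of_ray_subset (h : IsSolutionOn K q p) {a t : ℝ}
    (hray : ∀ r : ℝ, 0 ≤ r → a + r * (t - a) ∈ K) :
    ‖q t‖ ≤ Real.exp (energy (q a) (p a)) / (8 * |q a 0| * |q a 1|) := by
  have ha : a ∈ K := by simpa using hray 0 le_rfl
  have ht : t ∈ K := by simpa using hray 1 zero_le_one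
  have hle : ∀ i, |q a i| ≤ |q t i| := fun i =>
    le_of_concaveOn_of_ray_subset (h.concaveOn_abs i) (fun _ _ => abs_nonneg _) hray
  have h0 := abs_pos.2 ((h.collisionFree a ha).ne_zero 0)
  have h1 := abs_pos.2 ((h.collisionFree a ha).ne_zero 1)
  rw [le_div_iff₀ (by positivity)]
  calc ‖q t‖ * (8 * |q a 0| * |q a 1|) ≤ ‖q t‖ * (8 * |q t 0| * |q t 1|) := by
        gcongr ‖q t‖ * (8 * ?_ * ?_)
        · exact hle 0
        · exact hle 1
    _ = 8 * ‖q t‖ * |q t 0| * |q t 1| := by ring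
    _ ≤ _ := h.norm_mul_abs_mul_abs_le ha ht

lemma exists_abs_le (h : IsSolutionOn K q p) {a : ℝ} (ha : a ∈ K) (i : Fin 2) :
    ∃ m : ℝ, ∀ t ∈ K, |q t i| ≤ |q a i| + m * (t - a) := by
  obtain ⟨ε, hε⟩ := h.abs_eq i
  exact ⟨_, fun t ht => le_tangent_of_concaveOn (h.concaveOn_abs i) ha ht
    (((h.velocity_apply i ha).const_mul ε).congr hε (hε a ha))⟩

lemma norm_le_abs_add_abs (x : Plane) : ‖x‖ ≤ |x 0| + |x 1| := by
  rw [EuclideanSpace.norm_eq, Fin.sum_univ_two]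
  refine Real.sqrt_le_iff.2 ⟨by positivity, ?_⟩
  simp only [Real.norm_eq_abs]
  nlinarith [abs_nonneg (x 0), abs_nonneg (x 1)]

/-- On a bounded time interval the position stays bounded. -/
lemma isBounded_image_of_abs_sub_le (h : IsSolutionOn K q p) {S : Set ℝ} {a r : ℝ} (ha : a ∈ K)
    (hS : S ⊆ K) (hr : ∀ t ∈ S, |t - a| ≤ r) : Bornology.IsBounded (q '' S) := by
  obtain ⟨m, hm⟩ := h.exists_abs_le ha 0
  obtain ⟨n, hn⟩ := h.exists_abs_le ha 1
  refine isBounded_iff_forall_norm_le.2 ⟨|q a 0| + |q a 1| + (|m| + |n|) * r, ?_⟩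
  rintro _ ⟨t, ht, rfl⟩
  have key : ∀ c : ℝ, c * (t - a) ≤ |c| * r := fun c =>
    (le_abs_self _).trans ((abs_mul _ _).trans_le
      (mul_le_mul_of_nonneg_left (hr t ht) (abs_nonneg c)))
  linarith [norm_le_abs_add_abs (q t), hm t (hS ht), hn t (hS ht), key m, key n]

theorem isBounded_image (h : IsSolutionOn K q p) : Bornology.IsBounded (q '' K) := by
  rcases K.eq_empty_or_nonempty with rfl | ⟨a, ha⟩
  · simp
  -- The energy bound depends on `a` alone, hence is uniform in `t`.
  have hray : ∀ {S : Set ℝ}, (∀ t ∈ S, ∀ r : ℝ, 0 ≤ r → a + r * (t - a) ∈ K) →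
      Bornology.IsBounded (q '' S) := fun hS =>
    isBounded_iff_forall_norm_le.2 ⟨_, by
      rintro _ ⟨t, ht, rfl⟩
      exact h.norm_le_of_ray_subset (hS t ht)⟩
  have hright : Bornology.IsBounded (q '' (K ∩ Ici a)) := by
    by_cases hb : BddAbove K
    · obtain ⟨b, hb⟩ := hb
      refine h.isBounded_image_of_abs_sub_le (r := b - a) ha inter_subset_left fun t ht => ?_
      rw [abs_of_nonneg (sub_nonneg.2 ht.2)]
      linarith [hb ht.1]
    · rw [not_bddAbove_iff] at hb
      refine hray fun t ht r hr => ?_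
      obtain ⟨b, hbK, hlt⟩ := hb (a + r * (t - a))
      exact h.interval.out ha hbK
        ⟨le_add_of_nonneg_right (mul_nonneg hr (sub_nonneg.2 ht.2)), hlt.le⟩
  have hleft : Bornology.IsBounded (q '' (K ∩ Iic a)) := by
    by_cases hb : BddBelow K
    · obtain ⟨b, hb⟩ := hb
      refine h.isBounded_image_of_abs_sub_le (r := a - b) ha inter_subset_left fun t ht => ?_
      rw [abs_of_nonpos (sub_nonpos.2 ht.2)]
      linarith [hb ht.1]
    · rw [not_bddBelow_iff] at hb
      refine hray fun t ht r hr => ?_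
      obtain ⟨b, hbK, hlt⟩ := hb (a + r * (t - a))
      exact h.interval.out hbK ha
        ⟨hlt.le, add_le_of_nonpos_right
          (mul_nonpos_of_nonneg_of_nonpos hr (sub_nonpos.2 ht.2))⟩
  have hK : K = (K ∩ Iic a) ∪ (K ∩ Ici a) := by
    rw [← inter_union_distrib_left, Iic_union_Ici, inter_univ]
  rw [hK, image_union]
  exact hleft.union hright

end IsSolutionOn

/-! ### Cutting at the collision times -/

lemma IsGeneralizedSolution.isSolutionOn {J : Set ℝ} {Y : Finset ℝ} {q p : ℝ → Plane}
    (h : IsGeneralizedSolution J Y q p) {K : Set ℝ} (hK : K.OrdConnected)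
    (hKJ : K ⊆ J \ (Y : Set ℝ)) : IsSolutionOn K q p where
  interval := hK
  collisionFree t ht := h.collisionFree t (hKJ ht)
  velocity t ht := (h.velocity t (hKJ ht)).mono fun _ hs => (hKJ hs).1
  force t ht := (h.force t (hKJ ht)).mono fun _ hs => (hKJ hs).1

/-- The image of an interval is bounded if finitely many points can be removed such that the
images of all subintervals avoiding these points are bounded. -/
lemma isBounded_image_of_forall_ordConnected {E : Type*} [PseudoMetricSpace E] (f : ℝ → E)
    (Y : Finset ℝ) {J : Set ℝ} (hJ : J.OrdConnected)
    (h : ∀ K : Set ℝ, K.OrdConnected → K ⊆ J \ (Y : Set ℝ) → Bornology.IsBounded (f '' K)) :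
    Bornology.IsBounded (f '' J) := by
  induction Y using Finset.induction_on generalizing J with
  | empty => exact h J hJ (by simp)
  | insert y Y _ ih =>
    have hleft : Bornology.IsBounded (f '' (J ∩ Iio y)) := by
      refine ih (hJ.inter ordConnected_Iio) fun K hK hKJ => h K hK fun t ht => ?_
      obtain ⟨⟨h1, h2⟩, h3⟩ := hKJ ht
      exact ⟨h1, by simpa using ⟨ne_of_lt h2, h3⟩⟩
    have hright : Bornology.IsBounded (f '' (J ∩ Ioi y)) := by
      refine ih (hJ.inter ordConnected_Ioi) fun K hK hKJ => h K hK fun t ht => ?_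
      obtain ⟨⟨h1, h2⟩, h3⟩ := hKJ ht
      exact ⟨h1, by simpa using ⟨ne_of_gt h2, h3⟩⟩
    -- Adding the single point `f y` is harmless even if `y ∉ J`.
    refine ((hleft.union (Bornology.isBounded_singleton (x := f y))).union hright).subset ?_
    rintro _ ⟨t, ht, rfl⟩
    rcases lt_trichotomy t y with hlt | rfl | hgt
    · exact .inl (.inl ⟨t, ⟨ht, hlt⟩, rfl⟩)
    · exact .inl (.inr rfl)
    · exact .inr ⟨t, ⟨ht, hgt⟩, rfl⟩

end VortexD2

theorem mainTheorem4 (J : Set ℝ) (Y : Finset ℝ) (q p : ℝ → VortexD2.Plane)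
    (hq : VortexD2.IsGeneralizedSolution J Y q p) :
    Bornology.IsBounded (q '' J) :=
  VortexD2.isBounded_image_of_forall_ordConnected q Y hq.interval fun _ hK hKJ =>
    (hq.isSolutionOn hK hKJ).isBounded_image
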